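/- Let $\mathcal A$ be a unital $C^*$-algebra, let $n$ be a positive integer, let $\mathbb M_n$ be the algebra of complex $n\times n$ matrices, and let $\Phi:\mathcal A\to\mathbb M_n$ be a positive linear map that is sub-unital, i.e. $\Phi(I)\le I$. Let $A\in\mathcal A$ with $A\ge 0$, and let $p,q,r\ge 0$ be real numbers with $p\le q$ and $r\le q$. Then there are unitary matrices $U,V\in\mathbb M_n$ such that $$ |\Phi(A^p)\Phi(A^q)\Phi(A^r)|\le\frac{U\Phi(A^{p+q+r})U^*+V\Phi(A^{p+q+r})V^*}{2}. $$ Here $|X|=(X^*X)^{1/2}$, $X\le Y$ means that $Y-X$ is positive semidefinite, and the powers are taken by functional calculus, with $A^0=I$. -/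

import Mathlib

open scoped MatrixOrder

open scoped NNReal

/-! Put `B = Φ(A^q)` and split `B = B^(t/2) B^((2-t)/2)`, giving `X = Φ(A^p) B^(t/2)` and `Y =
B^((2-t)/2) Φ(A^r)`. Polar decomposition yields `2|XY| ≤ W* XX* W + Y*Y`, and `tq = q + r - p` gives
both `XX* = Φ(A^p) B^t Φ(A^p)` and `Y*Y = Φ(A^r) B^(2-t) Φ(A^r)` total degree `p + q + r`.

It remains to dominate each by a unitary conjugate of `Φ(A^(p+q+r))`. The tools are Jensen's `Φ(A)^t
≤ Φ(A^t)` for `1 ≤ t ≤ 2`, its reverse on `[0, 1]`, Löwner–Heinz monotonicity, and the unitary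
equivalence of `ZZ*` and `Z*Z`, which interchanges inner and outer factors. -/

theorem CFC.rpow_add_of_nonneg {A : Type*} [PartialOrder A] [Ring A] [StarRing A]
    [TopologicalSpace A] [StarOrderedRing A] [Algebra ℝ A]
    [ContinuousFunctionalCalculus ℝ A IsSelfAdjoint] [NonnegSpectrumClass ℝ A]
    [IsTopologicalRing A] [T2Space A] (a : A) {x y : ℝ} (hx : 0 ≤ x) (hy : 0 ≤ y) :
    a ^ (x + y) = a ^ x * a ^ y := by
  simp only [CFC.rpow_def]
  rw [← cfc_mul _ _ _ (NNReal.continuous_rpow_const hx).continuousOn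
    (NNReal.continuous_rpow_const hy).continuousOn]
  exact cfc_congr fun z _ => NNReal.rpow_add_of_nonneg z hx hy

/-! ### Unitary domination, polar decomposition, functional calculus of matrices. -/

namespace Matrix

variable {n m : Type*} [Fintype n] [DecidableEq n] [Fintype m] [DecidableEq m]

/-- `S` is dominated, in the Loewner order, by a unitary conjugate of `T`. -/
def UnitarilyDominated (S T : Matrix n n ℂ) : Prop :=
  ∃ U ∈ unitaryGroup n ℂ, S ≤ U * T * star U

theorem UnitarilyDominated.of_le {S T : Matrix n n ℂ} (h : S ≤ T) : UnitarilyDominated S T :=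
  ⟨1, one_mem _, by simpa using h⟩

theorem UnitarilyDominated.trans {R S T : Matrix n n ℂ} (h₁ : UnitarilyDominated R S)
    (h₂ : UnitarilyDominated S T) : UnitarilyDominated R T := by
  obtain ⟨U, hU, h₁⟩ := h₁
  obtain ⟨V, hV, h₂⟩ := h₂
  refine ⟨U * V, mul_mem hU hV, h₁.trans ?_⟩
  simpa [mul_assoc] using star_right_conjugate_le_conjugate h₂ U

theorem exists_unitary_conj_of_charpoly_eq {S T : Matrix n n ℂ} (hS : S.IsHermitian)
    (hT : T.IsHermitian) (h : S.charpoly = T.charpoly) :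
    ∃ U ∈ unitaryGroup n ℂ, S = U * T * star U := by
  have he := (hS.eigenvalues_eq_eigenvalues_iff hT).mpr h
  refine ⟨hS.eigenvectorUnitary * star hT.eigenvectorUnitary,
    mul_mem (SetLike.coe_mem _) (SetLike.coe_mem _), ?_⟩
  have h₁ := hS.spectral_theorem
  have h₂ := hT.conjStarAlgAut_star_eigenvectorUnitary
  rw [Unitary.conjStarAlgAut_apply] at h₁ h₂
  rw [he, ← h₂] at h₁
  simpa [mul_assoc] using h₁

theorem exists_unitary_mul_star_self (X : Matrix n n ℂ) :
    ∃ U ∈ unitaryGroup n ℂ, X * star X = U * (star X * X) * star U :=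
  exists_unitary_conj_of_charpoly_eq (isHermitian_mul_conjTranspose_self X)
    (isHermitian_conjTranspose_mul_self X) (charpoly_mul_comm _ _)

theorem unitarilyDominated_mul_star_self (X : Matrix n n ℂ) :
    UnitarilyDominated (X * star X) (star X * X) := by
  obtain ⟨U, hU, h⟩ := exists_unitary_mul_star_self X
  exact ⟨U, hU, h.le⟩

open scoped Matrix.Norms.L2Operator in
theorem exists_unitary_star_mul_eq_abs_of_normal (Z : Matrix n n ℂ) [hZ : IsStarNormal Z] :
    ∃ W ∈ unitaryGroup n ℂ, star W * Z = CFC.abs Z := by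
  have hfin : (spectrum ℂ Z).Finite := Z.finite_spectrum
  have hfin_q : (quasispectrum ℂ Z).Finite := by
    rw [quasispectrum_eq_spectrum_union_zero]
    exact hfin.union (Set.finite_singleton 0)
  have hc : ∀ f : ℂ → ℂ, ContinuousOn f (spectrum ℂ Z) := fun f => hfin.continuousOn f
  -- The phase of `Z`; the value 1 at 0 keeps it unitary on the kernel. Finiteness of the spectrum
  -- makes its discontinuity harmless.
  refine ⟨cfc (fun z : ℂ => if z = 0 then 1 else z / ‖z‖) Z, ?_, ?_⟩
  · rw [unitaryGroup, cfc_unitary_iff _ _ hZ (hc _)]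
    intro z _
    by_cases h : z = 0
    · simp [h]
    · have : (‖z‖ : ℂ) ≠ 0 := by simpa using h
      simp only [h, if_false, star_div₀, RCLike.star_def, Complex.conj_ofReal]
      rw [div_mul_div_comm, Complex.conj_mul']
      field_simp
  · rw [CFC.abs_eq_cfcₙ_coe_norm ℂ Z hZ, cfcₙ_eq_cfc (hf := hfin_q.continuousOn _), ← cfc_star]
    conv_lhs => enter [2]; rw [← cfc_id' ℂ Z]
    rw [← cfc_mul _ _ _ (hc _) (hc _)]
    refine cfc_congr fun z _ => ?_
    by_cases h : z = 0
    · simp [h]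
    · have : (‖z‖ : ℂ) ≠ 0 := by simpa using h
      simp only [h, if_false, star_div₀, RCLike.star_def, Complex.conj_ofReal]
      rw [div_mul_eq_mul_div, Complex.conj_mul']
      field_simp
      rfl

/-- Polar decomposition with a unitary factor. -/
theorem exists_unitary_star_mul_eq_abs (Z : Matrix n n ℂ) :
    ∃ W ∈ unitaryGroup n ℂ, star W * Z = CFC.abs Z := by
  obtain ⟨U, hU, h⟩ := exists_unitary_mul_star_self Z
  have hUU : star U * U = 1 := mem_unitaryGroup_iff'.mp hU
  have hUU' : U * star U = 1 := mem_unitaryGroup_iff.mp hU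
  -- Since `ZZ* = U Z*Z U*`, the matrix `U*Z` is normal with the same absolute value as `Z`.
  have h₁ : star (star U * Z) * (star U * Z) = star Z * Z := by
    rw [star_mul, star_star, mul_assoc, ← mul_assoc U, hUU', one_mul]
  have h₂ : (star U * Z) * star (star U * Z) = star Z * Z := by
    rw [star_mul, star_star, mul_assoc, ← mul_assoc Z, h]
    simp only [mul_assoc, hUU, mul_one]
    rw [← mul_assoc, hUU, one_mul]
  have : IsStarNormal (star U * Z) := ⟨by rw [Commute, SemiconjBy, h₁, h₂]⟩
  obtain ⟨W, hW, h₃⟩ := exists_unitary_star_mul_eq_abs_of_normal (star U * Z)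
  refine ⟨U * W, mul_mem hU hW, ?_⟩
  rw [star_mul, mul_assoc, h₃, CFC.abs, h₁, CFC.abs]

/-- The arithmetic-geometric mean inequality for the absolute value of a product. -/
theorem exists_unitary_two_smul_abs_mul_le (X Y : Matrix n n ℂ) :
    ∃ W ∈ unitaryGroup n ℂ,
      (2 : ℂ) • CFC.abs (X * Y) ≤ star W * (X * star X) * W + star Y * Y := by
  obtain ⟨W, hW, h⟩ := exists_unitary_star_mul_eq_abs (X * Y)
  refine ⟨W, hW, ?_⟩
  have h' : star Y * star X * W = CFC.abs (X * Y) := by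
    have := congrArg star h
    rwa [(CFC.abs_nonneg (X * Y)).isSelfAdjoint.star_eq, star_mul, star_star, star_mul] at this
  -- Both cross terms of this square equal `|XY|`.
  have := star_mul_self_nonneg (star X * W - Y)
  rw [← sub_nonneg]
  convert this using 1
  rw [star_sub, star_mul, star_star, sub_mul, mul_sub, mul_sub, two_smul]
  nth_rewrite 1 [← h]
  rw [← h']
  simp only [mul_assoc]
  abel

open scoped ComplexOrder in
/-- Functional calculus intertwines: `f(X*X) X* = X* f(XX*)`. -/
theorem cfc_conjTranspose_mul_self_mul (X : Matrix m n ℂ) (f : ℝ≥0 → ℝ≥0) :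
    cfc f (Xᴴ * X) * Xᴴ = Xᴴ * cfc f (X * Xᴴ) := by
  have h₁ : (0 : Matrix n n ℂ) ≤ Xᴴ * X := (posSemidef_conjTranspose_mul_self X).nonneg
  have h₂ : (0 : Matrix m m ℂ) ≤ X * Xᴴ := (posSemidef_self_mul_conjTranspose X).nonneg
  rw [cfc_nnreal_eq_real _ _ h₁, cfc_nnreal_eq_real _ _ h₂]
  set g : ℝ → ℝ := fun x => f x.toNNReal
  -- One polynomial interpolating on both spectra reduces the claim to monomials.
  set s : Finset ℝ := (finite_real_spectrum (A := Xᴴ * X)).toFinset ∪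
    (finite_real_spectrum (A := X * Xᴴ)).toFinset
  set q : Polynomial ℝ := Lagrange.interpolate s id g
  have hq : ∀ x ∈ s, q.eval x = g x := fun x hx =>
    Lagrange.eval_interpolate_at_node g Function.injective_id.injOn hx
  have e₁ : cfc g (Xᴴ * X) = Polynomial.aeval (Xᴴ * X) q := by
    rw [← cfc_polynomial q _ h₁.isSelfAdjoint]
    exact cfc_congr fun x hx => (hq x (by simp [s, hx])).symm
  have e₂ : cfc g (X * Xᴴ) = Polynomial.aeval (X * Xᴴ) q := by
    rw [← cfc_polynomial q _ h₂.isSelfAdjoint]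
    exact cfc_congr fun x hx => (hq x (by simp [s, hx])).symm
  rw [e₁, e₂]
  induction q using Polynomial.induction_on' with
  | add p q hp hq => simp [Matrix.add_mul, Matrix.mul_add, hp, hq]
  | monomial k a =>
    have : ∀ k : ℕ, (Xᴴ * X) ^ k * Xᴴ = Xᴴ * (X * Xᴴ) ^ k := fun k => by
      induction k with
      | zero => simp
      | succ k ih => rw [pow_succ', pow_succ', Matrix.mul_assoc, ih]; simp [Matrix.mul_assoc]
    simp [Polynomial.aeval_monomial, Algebra.algebraMap_eq_smul_one, this]

open scoped ComplexOrder in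
theorem cfc_diagonal_nnreal (f : ℝ≥0 → ℝ≥0) (d : n → ℝ≥0) :
    cfc f (diagonal fun i => ((d i : ℝ) : ℂ)) = diagonal fun i => ((f (d i) : ℝ) : ℂ) := by
  have h₁ : (0 : Matrix n n ℂ) ≤ diagonal fun i => ((d i : ℝ) : ℂ) :=
    (PosSemidef.diagonal fun i => by simp).nonneg
  rw [cfc_nnreal_eq_real _ _ h₁]
  set g : ℝ → ℝ := fun x => f x.toNNReal with hg
  set D : Matrix n n ℂ := diagonal fun i => ((d i : ℝ) : ℂ) with hD
  set s : Finset ℝ := (finite_real_spectrum (A := D)).toFinset ∪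
    Finset.univ.image fun i => (d i : ℝ)
  set q : Polynomial ℝ := Lagrange.interpolate s id g
  have hq : ∀ x ∈ s, q.eval x = g x := fun x hx =>
    Lagrange.eval_interpolate_at_node g Function.injective_id.injOn hx
  have e₁ : cfc g D = Polynomial.aeval D q := by
    rw [← cfc_polynomial q _ h₁.isSelfAdjoint]
    exact cfc_congr fun x hx => (hq x (by simp [s, hx])).symm
  have e₂ : ∀ p : Polynomial ℝ, Polynomial.aeval D p =
      diagonal fun i => ((p.eval (d i : ℝ) : ℝ) : ℂ) := fun p => by
    induction p using Polynomial.induction_on' with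
    | add p q hp hq => simp [hp, hq]
    | monomial k a =>
      rw [Polynomial.aeval_monomial, Algebra.algebraMap_eq_smul_one, smul_mul_assoc, one_mul, hD,
        diagonal_pow]
      ext i j
      by_cases hij : i = j
      · subst hij; simp
      · simp [hij]
  rw [e₁, e₂]
  congr 1
  ext i
  rw [hq _ (by simp [s])]
  simp [hg]

end Matrix

/-! ### Operator Jensen inequality for finite families. -/

namespace Matrix

variable {n m ι : Type*} [Fintype n] [DecidableEq n] [Fintype m] [DecidableEq m] [Fintype ι]
  [DecidableEq ι]

-- `V*V` and `VV*` have the same norm.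
open scoped Matrix.Norms.L2Operator ComplexOrder in
theorem mul_conjTranspose_self_le_one {V : Matrix m n ℂ} (h : Vᴴ * V ≤ 1) : V * Vᴴ ≤ 1 := by
  have h₁ : (0 : Matrix n n ℂ) ≤ Vᴴ * V := (posSemidef_conjTranspose_mul_self V).nonneg
  have h₂ : (0 : Matrix m m ℂ) ≤ V * Vᴴ := (posSemidef_self_mul_conjTranspose V).nonneg
  rw [← CStarAlgebra.norm_le_one_iff_of_nonneg _ h₂]
  rw [← CStarAlgebra.norm_le_one_iff_of_nonneg _ h₁] at h
  have h₃ := l2_opNorm_conjTranspose_mul_self V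
  have h₄ := l2_opNorm_conjTranspose_mul_self Vᴴ
  rw [conjTranspose_conjTranspose, l2_opNorm_conjTranspose] at h₄
  rwa [h₄, ← h₃]

open scoped ComplexOrder in
theorem conjTranspose_mul_mul_mono {n m : Type*} [Fintype n] [Fintype m]
    {S T : Matrix m m ℂ} (h : S ≤ T) (X : Matrix m n ℂ) :
    Xᴴ * S * X ≤ Xᴴ * T * X := by
  rw [le_iff] at h ⊢
  have := h.conjTranspose_mul_mul_same X
  rwa [Matrix.mul_sub, Matrix.sub_mul] at this

open scoped ComplexOrder in
theorem rpow_conjTranspose_mul_self (X : Matrix m n ℂ) {u : ℝ} (hu : 0 ≤ u) :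
    (Xᴴ * X) ^ (1 + u) = Xᴴ * (X * Xᴴ) ^ u * X := by
  have h₁ : (0 : Matrix n n ℂ) ≤ Xᴴ * X := (posSemidef_conjTranspose_mul_self X).nonneg
  rw [add_comm, CFC.rpow_add_of_nonneg _ hu zero_le_one, CFC.rpow_one _ h₁, CFC.rpow_def,
    CFC.rpow_def, ← Matrix.mul_assoc, cfc_conjTranspose_mul_self_mul]

theorem rpow_diagonal (d : n → ℝ≥0) (u : ℝ) :
    (diagonal fun i => ((d i : ℝ) : ℂ)) ^ u = diagonal fun i => (((d i ^ u : ℝ≥0) : ℝ) : ℂ) := by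
  rw [CFC.rpow_def, cfc_diagonal_nnreal]

/-- The columns `√(E i)`, stacked and weighted by `c i`. -/
noncomputable def stackedSqrt (E : ι → Matrix n n ℂ) : Matrix (ι × n) n ℂ :=
  of fun p k => CFC.sqrt (E p.1) p.2 k

/-- A dilation: weighted sums of the `E i` come from diagonal matrices, whose powers are entrywise.
-/
theorem stackedSqrt_conj_diagonal {E : ι → Matrix n n ℂ} (hE : ∀ i, 0 ≤ E i) (d : ι → ℂ) :
    (stackedSqrt E)ᴴ * diagonal (fun p : ι × n => d p.1) * stackedSqrt E = ∑ i, d i • E i := by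
  ext j k
  rw [Matrix.mul_assoc, mul_apply, Fintype.sum_prod_type, sum_apply]
  refine Finset.sum_congr rfl fun i _ => ?_
  have h : star (CFC.sqrt (E i)) * CFC.sqrt (E i) = E i := by
    rw [(CFC.sqrt_nonneg (E i)).isSelfAdjoint.star_eq, CFC.sqrt_mul_sqrt_self _ (hE i)]
  conv_rhs => rw [← h]
  rw [smul_apply, mul_apply, smul_eq_mul, Finset.mul_sum]
  refine Finset.sum_congr rfl fun l _ => ?_
  simp only [stackedSqrt, conjTranspose_apply, of_apply, diagonal_mul, star_apply]
  ring

open scoped Matrix.Norms.L2Operator in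
/-- Operator Jensen inequality for powers between one and two, for subnormalised finite families
of positive weights. -/
theorem rpow_sum_smul_le {E : ι → Matrix n n ℂ} (hE : ∀ i, 0 ≤ E i) (hsum : ∑ i, E i ≤ 1)
    (a : ι → ℝ≥0) {t : ℝ} (ht₁ : 1 ≤ t) (ht₂ : t ≤ 2) :
    (∑ i, ((a i : ℝ) : ℂ) • E i) ^ t ≤ ∑ i, (((a i ^ t : ℝ≥0) : ℝ) : ℂ) • E i := by
  set V := stackedSqrt E
  set D : Matrix (ι × n) (ι × n) ℂ := diagonal fun p => ((NNReal.sqrt (a p.1) : ℝ) : ℂ) with hD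
  have hDs : Dᴴ = D := by
    rw [hD, diagonal_conjTranspose]; congr 1; ext p; simp
  have hDD : D * D = diagonal fun p => ((a p.1 : ℝ) : ℂ) := by
    rw [hD, diagonal_mul_diagonal]
    congr 1; ext p
    rw [← Complex.ofReal_mul, ← NNReal.coe_mul, NNReal.mul_self_sqrt]
  have hV : Vᴴ * V ≤ 1 := by
    have := stackedSqrt_conj_diagonal hE (fun _ => 1)
    simp only [diagonal_one, Matrix.mul_one, one_smul] at this
    rwa [this]
  have hX : (D * V)ᴴ * (D * V) = ∑ i, ((a i : ℝ) : ℂ) • E i := by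
    rw [conjTranspose_mul, hDs, ← stackedSqrt_conj_diagonal hE, ← hDD]
    simp only [Matrix.mul_assoc, V]
  have hXX : (D * V) * (D * V)ᴴ ≤ diagonal fun p => ((a p.1 : ℝ) : ℂ) := by
    have := conjTranspose_mul_mul_mono (mul_conjTranspose_self_le_one hV) D
    rw [hDs, Matrix.mul_one, hDD] at this
    simpa only [conjTranspose_mul, hDs, Matrix.mul_assoc] using this
  -- With `X = DV`, `(X*X)^t = X* (XX*)^(t-1) X`, and Löwner–Heinz applies to `XX* ≤ D²`.
  have hu : t - 1 ∈ Set.Icc (0 : ℝ) 1 := ⟨by linarith, by linarith⟩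
  have hpow := CFC.rpow_le_rpow hu hXX
  rw [rpow_diagonal (fun p : ι × n => a p.1)] at hpow
  have h := conjTranspose_mul_mul_mono hpow (D * V)
  rw [← rpow_conjTranspose_mul_self _ hu.1, hX, add_sub_cancel] at h
  refine h.trans_eq ?_
  rw [← stackedSqrt_conj_diagonal hE, conjTranspose_mul, hDs]
  have : D * (diagonal fun p : ι × n => (((a p.1 ^ (t - 1) : ℝ≥0) : ℝ) : ℂ)) * D =
      diagonal fun p => (((a p.1 ^ t : ℝ≥0) : ℝ) : ℂ) := by
    rw [hD, diagonal_mul_diagonal, diagonal_mul_diagonal]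
    congr 1; ext p
    rw [← Complex.ofReal_mul, ← Complex.ofReal_mul, ← NNReal.coe_mul, ← NNReal.coe_mul,
      mul_right_comm, NNReal.mul_self_sqrt]
    congr 2
    conv_lhs => rw [← NNReal.rpow_one (a p.1), ← NNReal.rpow_mul, one_mul]
    rw [← NNReal.rpow_add_of_nonneg _ zero_le_one hu.1, add_sub_cancel]
  rw [← this]
  simp only [Matrix.mul_assoc, V]

end Matrix

/-! ### Jensen inequality for positive maps, by Bernstein approximation. -/

section PositiveMap

variable {𝒜 : Type*} [CStarAlgebra 𝒜] [PartialOrder 𝒜] [StarOrderedRing 𝒜]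
  {n : Type*} [Fintype n] [DecidableEq n]

open Matrix Filter Topology Set

theorem bernstein_sum_smul (N : ℕ) (x : unitInterval) :
    ∑ k : Fin (N + 1), bernstein N k x * (k : ℝ) = N * x := by
  have := congrArg (Polynomial.aeval (x : ℝ)) (bernsteinPolynomial.sum_smul ℝ N)
  simp only [map_sum, nsmul_eq_mul, Finset.sum_range, map_mul, map_natCast,
    Polynomial.aeval_X] at this
  rw [← this]
  refine Finset.sum_congr rfl fun k _ => ?_
  rw [mul_comm]
  rfl

/-- The Bernstein weights rescaled to the interval `[0, c]`, extended constantly. -/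
noncomputable def scaledBernstein (c : ℝ) (N : ℕ) (k : ℕ) (x : ℝ) : ℝ :=
  bernstein N k (projIcc 0 1 zero_le_one (x / c))

theorem continuous_scaledBernstein (c : ℝ) (N k : ℕ) : Continuous (scaledBernstein c N k) :=
  (bernstein N k).continuous.comp (continuous_projIcc.comp (continuous_id.div_const c))

theorem sum_scaledBernstein (c : ℝ) (N : ℕ) (x : ℝ) :
    ∑ k : Fin (N + 1), scaledBernstein c N k x = 1 := bernstein.probability N _

/-- Exact reproduction of the identity leaves a limit on only one side of Jensen's inequality. -/
theorem sum_scaledBernstein_mul {c : ℝ} (hc : 0 < c) {N : ℕ} (hN : N ≠ 0) {x : ℝ}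
    (hx : x ∈ Icc 0 c) :
    ∑ k : Fin (N + 1), (c * (k / N)) * scaledBernstein c N k x = x := by
  have hxc : x / c ∈ Icc (0 : ℝ) 1 := ⟨div_nonneg hx.1 hc.le, (div_le_one hc).2 hx.2⟩
  have h := bernstein_sum_smul N (projIcc 0 1 zero_le_one (x / c))
  rw [projIcc_of_mem _ hxc] at h
  have hN' : (N : ℝ) ≠ 0 := Nat.cast_ne_zero.2 hN
  calc _ = c / N * ∑ k : Fin (N + 1), bernstein N k ⟨x / c, hxc⟩ * (k : ℝ) := by
        rw [Finset.mul_sum]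
        refine Finset.sum_congr rfl fun k _ => ?_
        rw [scaledBernstein, projIcc_of_mem _ hxc]
        field_simp
    _ = x := by rw [h]; field_simp

theorem tendstoUniformlyOn_scaledBernstein {c : ℝ} (hc : 0 < c) {f : ℝ → ℝ} (hf : Continuous f) :
    TendstoUniformlyOn
      (fun N x => ∑ k : Fin (N + 1), f (c * (k / N)) * scaledBernstein c N k x) f atTop
      (Icc 0 c) := by
  let F : C(unitInterval, ℝ) := ⟨fun y => f (c * y), by fun_prop⟩
  have h := bernsteinApproximation_uniform F
  rw [ContinuousMap.tendsto_iff_tendstoUniformly] at h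
  rw [Metric.tendstoUniformlyOn_iff]
  rw [Metric.tendstoUniformly_iff] at h
  intro ε hε
  filter_upwards [h ε hε] with N hN x hx
  have hxc : x / c ∈ Icc (0 : ℝ) 1 := ⟨div_nonneg hx.1 hc.le, (div_le_one hc).2 hx.2⟩
  have h₁ := hN ⟨x / c, hxc⟩
  rw [bernsteinApproximation.apply] at h₁
  convert h₁ using 2
  · simp only [F, ContinuousMap.coe_mk]
    rw [mul_div_cancel₀ _ hc.ne']
  · refine Finset.sum_congr rfl fun k _ => ?_
    rw [scaledBernstein, projIcc_of_mem _ hxc, smul_eq_mul, mul_comm]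
    rfl

open scoped Matrix.Norms.L2Operator in
theorem PositiveLinearMap.continuous_toMatrix (Φ : 𝒜 →ₚ[ℂ] Matrix n n ℂ) : Continuous Φ := by
  obtain ⟨C, hC⟩ := Φ.exists_norm_apply_le
  exact AddMonoidHomClass.continuous_of_bound Φ C hC

-- The images under `Φ` of the Bernstein weights at `A` are positive with sum `Φ 1 ≤ 1`, so the
-- finite inequality applies; then `N → ∞`.
open scoped Matrix.Norms.L2Operator in
theorem PositiveLinearMap.apply_rpow_le (Φ : 𝒜 →ₚ[ℂ] Matrix n n ℂ) (hΦ : Φ 1 ≤ 1) {A : 𝒜}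
    (hA : 0 ≤ A) {t : ℝ} (ht₁ : 1 ≤ t) (ht₂ : t ≤ 2) : Φ A ^ t ≤ Φ (A ^ t) := by
  have ht₀ : 0 ≤ t := zero_le_one.trans ht₁
  set c : ℝ := ‖A‖ * ‖(1 : 𝒜)‖ + 1
  have hc : 0 < c := by positivity
  have hspec : spectrum ℝ A ⊆ Icc 0 c := fun x hx =>
    ⟨spectrum_nonneg_of_nonneg hA hx, (Real.le_norm_self x).trans
      ((spectrum.norm_le_norm_mul_of_mem hx).trans (le_add_of_nonneg_right zero_le_one))⟩
  let E : ∀ N : ℕ, Fin (N + 1) → Matrix n n ℂ := fun N k => Φ (cfc (scaledBernstein c N k) A)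
  have hE : ∀ N k, 0 ≤ E N k := fun N k =>
    Φ.map_nonneg (cfc_nonneg fun x _ => bernstein_nonneg)
  have hlin : ∀ N (d : Fin (N + 1) → ℝ), ∑ k, (d k : ℂ) • E N k =
      Φ (cfc (fun x => ∑ k, d k * scaledBernstein c N k x) A) := by
    intro N d
    have := cfc_sum_univ (fun (k : Fin (N + 1)) x => d k * scaledBernstein c N k x) A
      (fun k => (continuous_const.mul (continuous_scaledBernstein c N k)).continuousOn)
    have h' : (fun x => ∑ k, d k * scaledBernstein c N k x) =
      ∑ k : Fin (N + 1), fun x => d k * scaledBernstein c N k x := by ext; simp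
    rw [h', this, map_sum]
    refine Finset.sum_congr rfl fun k _ => ?_
    rw [cfc_const_mul _ _ _ (continuous_scaledBernstein c N k).continuousOn,
      ← Complex.coe_smul, map_smul]
  have hsum : ∀ N, ∑ k, E N k ≤ 1 := by
    intro N
    have := hlin N (fun _ => 1)
    simp only [Complex.ofReal_one, one_smul, one_mul, sum_scaledBernstein] at this
    rw [this, cfc_const_one ℝ A]
    exact hΦ
  have hpow : Continuous fun x : ℝ => x ^ t := Real.continuous_rpow_const ht₀
  have hlim : Tendsto (fun N : ℕ => ∑ k : Fin (N + 1), (((c * (k / N)) ^ t : ℝ) : ℂ) • E N k) atTop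
      (𝓝 (Φ (A ^ t))) := by
    rw [CFC.rpow_eq_cfc_real hA]
    simp only [hlin]
    exact (Φ.continuous_toMatrix.tendsto _).comp <| tendsto_cfc_fun
      ((tendstoUniformlyOn_scaledBernstein hc hpow).mono hspec)
      (Eventually.of_forall fun N => (continuous_finsetSum Finset.univ fun (k : Fin (N + 1)) _ =>
        continuous_const.mul (continuous_scaledBernstein c N k)).continuousOn)
  have hle : ∀ᶠ N : ℕ in atTop,
      Φ A ^ t ≤ ∑ k : Fin (N + 1), (((c * (k / N)) ^ t : ℝ) : ℂ) • E N k := by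
    filter_upwards [eventually_ne_atTop 0] with N hN
    have h := rpow_sum_smul_le (hE N) (hsum N)
      (fun k => (⟨c * (k / N), by positivity⟩ : ℝ≥0)) ht₁ ht₂
    have h₀ : ∑ k : Fin (N + 1), ((c * (k / N) : ℝ) : ℂ) • E N k = Φ A := by
      rw [hlin]
      conv_rhs => rw [← cfc_id' ℝ A]
      congr 1
      exact cfc_congr fun x hx => sum_scaledBernstein_mul hc hN (hspec hx)
    change (∑ k : Fin (N + 1), ((c * (k / N) : ℝ) : ℂ) • E N k) ^ t ≤
      ∑ k : Fin (N + 1), (((c * (k / N)) ^ t : ℝ) : ℂ) • E N k at h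
    rwa [h₀] at h
  exact ge_of_tendsto hlim hle

end PositiveMap

/-! ### Power inequalities and the key estimate. -/

section PositiveMapPowers

variable {𝒜 : Type*} [CStarAlgebra 𝒜] [PartialOrder 𝒜] [StarOrderedRing 𝒜]
  {n : Type*} [Fintype n] [DecidableEq n]

open Matrix Set

namespace Matrix

/-- The two sides are `ZZ*` and `Z*Z` for `Z = C √G`. -/
theorem unitarilyDominated_conj_swap {C G : Matrix n n ℂ} (hC : 0 ≤ C) (hG : 0 ≤ G) :
    UnitarilyDominated (C * G * C) (CFC.sqrt G * (C * C) * CFC.sqrt G) := by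
  have h := unitarilyDominated_mul_star_self (C * CFC.sqrt G)
  rw [star_mul, (CFC.sqrt_nonneg G).isSelfAdjoint.star_eq, hC.isSelfAdjoint.star_eq] at h
  have h₁ : C * CFC.sqrt G * (CFC.sqrt G * C) = C * G * C := by
    rw [mul_assoc, ← mul_assoc (CFC.sqrt G), CFC.sqrt_mul_sqrt_self G hG, mul_assoc]
  have h₂ : CFC.sqrt G * C * (C * CFC.sqrt G) = CFC.sqrt G * (C * C) * CFC.sqrt G := by
    simp only [mul_assoc]
  rwa [h₁, h₂] at h

theorem unitarilyDominated_sqrt_conj_swap {F G : Matrix n n ℂ} (hF : 0 ≤ F) (hG : 0 ≤ G) :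
    UnitarilyDominated (CFC.sqrt F * G * CFC.sqrt F) (CFC.sqrt G * F * CFC.sqrt G) := by
  have h := unitarilyDominated_conj_swap (CFC.sqrt_nonneg F) hG
  rwa [CFC.sqrt_mul_sqrt_self F hF] at h

theorem sqrt_conj_rpow (F : Matrix n n ℂ) {u : ℝ} (hu : 0 ≤ u) :
    CFC.sqrt F * F ^ u * CFC.sqrt F = F ^ (1 + u) := by
  rw [CFC.sqrt_eq_rpow, ← CFC.rpow_add_of_nonneg _ (by norm_num) hu,
    ← CFC.rpow_add_of_nonneg _ (by positivity) (by norm_num)]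
  ring_nf

theorem sqrt_conj_mono {S T : Matrix n n ℂ} (h : S ≤ T) (F : Matrix n n ℂ) :
    CFC.sqrt F * S * CFC.sqrt F ≤ CFC.sqrt F * T * CFC.sqrt F :=
  conjugate_le_conjugate_of_nonneg h (CFC.sqrt_nonneg F)

end Matrix

namespace PositiveLinearMap

theorem map_rpow_nonneg {n : Type*} (Φ : 𝒜 →ₚ[ℂ] Matrix n n ℂ) (A : 𝒜) (p : ℝ) : 0 ≤ Φ (A ^ p) :=
  Φ.map_nonneg CFC.rpow_nonneg

theorem map_rpow_rpow_le (Φ : 𝒜 →ₚ[ℂ] Matrix n n ℂ) (hΦ : Φ 1 ≤ 1) {A : 𝒜}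
    (hA : 0 ≤ A) {v t : ℝ} (hv : 0 ≤ v) (ht₁ : 1 ≤ t) (ht₂ : t ≤ 2) :
    Φ (A ^ v) ^ t ≤ Φ (A ^ (v * t)) := by
  have := Φ.apply_rpow_le hΦ (A := A ^ v) CFC.rpow_nonneg ht₁ ht₂
  rwa [CFC.rpow_rpow_of_exponent_nonneg A v t hv (by linarith) hA] at this

-- Jensen with exponent `1/u ∈ [1, 2]`, then Löwner–Heinz with exponent `u`.
open scoped Matrix.Norms.L2Operator in
theorem map_rpow_le_rpow_of_half_le (Φ : 𝒜 →ₚ[ℂ] Matrix n n ℂ) (hΦ : Φ 1 ≤ 1) {A : 𝒜}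
    (hA : 0 ≤ A) {v u : ℝ} (hv : 0 ≤ v) (hu₁ : 1 / 2 ≤ u)
    (hu₂ : u ≤ 1) : Φ (A ^ (v * u)) ≤ Φ (A ^ v) ^ u := by
  have hu : 0 < u := by linarith
  have h := Φ.map_rpow_rpow_le hΦ hA (v := v * u) (t := u⁻¹) (by positivity)
    ((one_le_inv₀ hu).2 hu₂) ((inv_le_comm₀ hu two_pos).2 (by linarith))
  rw [mul_inv_cancel_right₀ hu.ne'] at h
  have h' := CFC.rpow_le_rpow (p := u) ⟨hu.le, hu₂⟩ h
  rwa [CFC.rpow_rpow_of_exponent_nonneg _ _ _ (by positivity) hu.le (Φ.map_rpow_nonneg A _),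
    inv_mul_cancel₀ hu.ne', CFC.rpow_one _ (Φ.map_rpow_nonneg A _)] at h'

open scoped Matrix.Norms.L2Operator in
theorem map_rpow_le_rpow (Φ : 𝒜 →ₚ[ℂ] Matrix n n ℂ) (hΦ : Φ 1 ≤ 1) {A : 𝒜}
    (hA : 0 ≤ A) {v u : ℝ} (hv : 0 ≤ v) (hu₀ : 0 ≤ u) (hu₁ : u ≤ 1) :
    Φ (A ^ (v * u)) ≤ Φ (A ^ v) ^ u := by
  rcases hu₀.eq_or_lt with rfl | hu
  · rw [mul_zero, CFC.rpow_zero A hA, CFC.rpow_zero _ (Φ.map_rpow_nonneg A v)]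
    exact hΦ
  -- Smaller exponents are reached by repeated halving.
  have key : ∀ k : ℕ, ∀ w : ℝ, (1 / 2) ^ k ≤ w → w ≤ 1 → Φ (A ^ (v * w)) ≤ Φ (A ^ v) ^ w := by
    intro k
    induction k with
    | zero =>
      intro w h₁ h₂
      obtain rfl : w = 1 := le_antisymm h₂ (by simpa using h₁)
      rw [mul_one, CFC.rpow_one _ (Φ.map_rpow_nonneg A v)]
    | succ k ih =>
      intro w h₁ h₂
      rcases le_or_gt (1 / 2) w with h | h
      · exact Φ.map_rpow_le_rpow_of_half_le hΦ hA hv h h₂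
      have hw : 0 < w := lt_of_lt_of_le (by positivity) h₁
      have h₃ := ih (2 * w) (by rw [pow_succ] at h₁; linarith) (by linarith)
      have h₄ := Φ.map_rpow_le_rpow_of_half_le hΦ hA (v := v * (2 * w)) (by positivity)
        le_rfl (by norm_num)
      have h₅ := CFC.rpow_le_rpow (p := 1 / 2) ⟨by norm_num, by norm_num⟩ h₃
      rw [CFC.rpow_rpow_of_exponent_nonneg _ _ _ (by positivity) (by norm_num)
        (Φ.map_rpow_nonneg A v)] at h₅
      convert h₄.trans h₅ using 3 <;> ring_nf
  obtain ⟨k, hk⟩ := exists_pow_lt_of_lt_one hu (by norm_num : (1 / 2 : ℝ) < 1)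
  exact key k u hk.le hu₁

/-- Bounding `Φ(A^w)` by `Φ(A^v)^(w/v)` leaves a single power with exponent `1 + w/v ∈ [1, 2]`,
where Jensen applies. -/
theorem sqrt_conj_map_rpow_le (Φ : 𝒜 →ₚ[ℂ] Matrix n n ℂ) (hΦ : Φ 1 ≤ 1) {A : 𝒜}
    (hA : 0 ≤ A) {v w : ℝ} (hw : 0 ≤ w) (hwv : w ≤ v) :
    CFC.sqrt (Φ (A ^ v)) * Φ (A ^ w) * CFC.sqrt (Φ (A ^ v)) ≤ Φ (A ^ (v + w)) := by
  have hv := hw.trans hwv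
  have hu₁ : w / v ≤ 1 := div_le_one_of_le₀ hwv hv
  have hu₀ : 0 ≤ w / v := by positivity
  have hvw : v * (w / v) = w := by
    rcases hv.eq_or_lt with rfl | h
    · simp [le_antisymm hwv hw]
    · field_simp
  have h₁ := Φ.map_rpow_le_rpow hΦ hA hv hu₀ hu₁
  rw [hvw] at h₁
  have h₂ := sqrt_conj_mono h₁ (Φ (A ^ v))
  rw [sqrt_conj_rpow _ hu₀] at h₂
  have h₃ := Φ.map_rpow_rpow_le hΦ hA hv (t := 1 + w / v) (by linarith) (by linarith)
  rw [mul_add, hvw, mul_one] at h₃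
  exact h₂.trans h₃

theorem unitarilyDominated_sqrt_conj_map_rpow (Φ : 𝒜 →ₚ[ℂ] Matrix n n ℂ) (hΦ : Φ 1 ≤ 1) {A : 𝒜}
    (hA : 0 ≤ A) {v w : ℝ} (hv : 0 ≤ v) (hw : 0 ≤ w) :
    UnitarilyDominated (CFC.sqrt (Φ (A ^ v)) * Φ (A ^ w) * CFC.sqrt (Φ (A ^ v)))
      (Φ (A ^ (v + w))) := by
  rcases le_total w v with h | h
  · exact .of_le (Φ.sqrt_conj_map_rpow_le hΦ hA hw h)
  · refine (unitarilyDominated_sqrt_conj_swap (Φ.map_rpow_nonneg A v)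
      (Φ.map_rpow_nonneg A w)).trans (.of_le ?_)
    rw [add_comm v w]
    exact Φ.sqrt_conj_map_rpow_le hΦ hA hv h

theorem map_rpow_mul_self_le (Φ : 𝒜 →ₚ[ℂ] Matrix n n ℂ) (hΦ : Φ 1 ≤ 1) {A : 𝒜}
    (hA : 0 ≤ A) {p : ℝ} (hp : 0 ≤ p) :
    Φ (A ^ p) * Φ (A ^ p) ≤ Φ (A ^ (2 * p)) := by
  have h := Φ.map_rpow_rpow_le hΦ hA hp (t := 2) one_le_two le_rfl
  have h₂ : Φ (A ^ p) ^ (2 : ℝ) = Φ (A ^ p) * Φ (A ^ p) := by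
    rw [← one_add_one_eq_two, CFC.rpow_add_of_nonneg _ zero_le_one zero_le_one,
      CFC.rpow_one _ (Φ.map_rpow_nonneg A p)]
  rwa [h₂, mul_comm p] at h

open scoped Matrix.Norms.L2Operator in
/-- The key estimate: `Φ(A^p) Φ(A^q)^t Φ(A^p)` is dominated by a unitary conjugate of the value
of `Φ` at the power of the same total degree. -/
theorem unitarilyDominated_conj_map_rpow (Φ : 𝒜 →ₚ[ℂ] Matrix n n ℂ) (hΦ : Φ 1 ≤ 1) {A : 𝒜}
    (hA : 0 ≤ A) {p q t : ℝ} (hp : 0 ≤ p) (hq : 0 ≤ q)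
    (ht₀ : 0 ≤ t) (ht₂ : t ≤ 2) (hq₀ : q = 0 → 1 ≤ t) (hpqt : q ≤ 2 * p + t * q) :
    UnitarilyDominated (Φ (A ^ p) * Φ (A ^ q) ^ t * Φ (A ^ p)) (Φ (A ^ (2 * p + t * q))) := by
  have hC := Φ.map_rpow_nonneg A p
  have hB := Φ.map_rpow_nonneg A q
  have hF := Φ.map_rpow_nonneg A (2 * p)
  have hsq := Φ.map_rpow_mul_self_le hΦ hA hp
  rcases le_or_gt 1 t with ht | ht
  -- For `t ≥ 1`, Jensen absorbs `t` into the power of `A`.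
  · have h₁ := Φ.map_rpow_rpow_le hΦ hA hq ht ht₂
    refine (UnitarilyDominated.of_le (conjugate_le_conjugate_of_nonneg h₁ hC)).trans ?_
    refine (unitarilyDominated_conj_swap hC (Φ.map_rpow_nonneg A _)).trans ?_
    refine (UnitarilyDominated.of_le (sqrt_conj_mono hsq _)).trans ?_
    have := Φ.unitarilyDominated_sqrt_conj_map_rpow hΦ hA (v := q * t) (w := 2 * p)
      (by positivity) (by positivity)
    rwa [show q * t + 2 * p = 2 * p + t * q by ring] at this
  have hq' : 0 < q := hq.lt_of_ne fun h => (hq₀ h.symm).not_gt ht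
  have hBt : 0 ≤ Φ (A ^ q) ^ t := CFC.rpow_nonneg
  refine (unitarilyDominated_conj_swap hC hBt).trans ?_
  refine (UnitarilyDominated.of_le (sqrt_conj_mono hsq _)).trans ?_
  rcases le_or_gt (2 * p) q with h | h
  -- Everything becomes a power of `Φ(A^q)`; the exponent `t + 2p/q` is at least 1 by `hpqt` and at
  -- most 2.
  · have hu : 2 * p / q ≤ 1 := (div_le_one hq').2 h
    have hu₀ : 0 ≤ 2 * p / q := by positivity
    have hqu : q * (2 * p / q) = 2 * p := by field_simp
    have h₁ := Φ.map_rpow_le_rpow hΦ hA hq hu₀ hu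
    rw [hqu] at h₁
    refine (UnitarilyDominated.of_le (sqrt_conj_mono h₁ _)).trans (.of_le ?_)
    have h₂ : CFC.sqrt (Φ (A ^ q) ^ t) = Φ (A ^ q) ^ (t / 2) := by
      rw [CFC.sqrt_eq_rpow, CFC.rpow_rpow_of_exponent_nonneg _ _ _ ht₀ (by norm_num) hB]
      ring_nf
    rw [h₂, ← CFC.rpow_add_of_nonneg _ (by positivity) hu₀,
      ← CFC.rpow_add_of_nonneg _ (by positivity) (by positivity)]
    have h₃ : 1 ≤ t / 2 + 2 * p / q + t / 2 := by
      have : 1 ≤ (2 * p + t * q) / q := (one_le_div hq').2 hpqt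
      rw [add_div, mul_div_cancel_right₀ _ hq'.ne'] at this
      linarith
    have h₄ := Φ.map_rpow_rpow_le hΦ hA hq h₃ (by linarith)
    convert h₄ using 3
    field_simp
    ring
  -- Here `2p > q`, so after a swap everything becomes a power of `Φ(A^(2p))`.
  · have hp' : 0 < 2 * p := hq'.trans h
    refine (unitarilyDominated_sqrt_conj_swap hBt hF).trans (.of_le ?_)
    have hu : q / (2 * p) ≤ 1 := (div_le_one hp').2 h.le
    have hu₀ : 0 ≤ q / (2 * p) := by positivity
    have h₁ := Φ.map_rpow_le_rpow hΦ hA hp'.le hu₀ hu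
    rw [mul_div_cancel₀ _ hp'.ne'] at h₁
    have h₂ := CFC.rpow_le_rpow (p := t) ⟨ht₀, ht.le⟩ h₁
    rw [CFC.rpow_rpow_of_exponent_nonneg _ _ _ hu₀ ht₀ hF] at h₂
    have h₃ := sqrt_conj_mono h₂ (Φ (A ^ (2 * p)))
    rw [sqrt_conj_rpow _ (by positivity)] at h₃
    have hle : q / (2 * p) * t ≤ 1 := mul_le_one₀ hu ht₀ ht.le
    have h₄ := Φ.map_rpow_rpow_le hΦ hA hp'.le (t := 1 + q / (2 * p) * t)
      (le_add_of_nonneg_right (by positivity)) (by linarith)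
    rw [mul_add, mul_one, ← mul_assoc, mul_div_cancel₀ _ hp'.ne', mul_comm q] at h₄
    exact h₃.trans h₄

end PositiveLinearMap

end PositiveMapPowers

/-! ### The main theorem. -/

theorem proposition1p4 {𝒜 : Type*} [CStarAlgebra 𝒜] [PartialOrder 𝒜] [StarOrderedRing 𝒜]
    (n : ℕ) (Φ : 𝒜 →ₚ[ℂ] Matrix (Fin n) (Fin n) ℂ) (hΦ : Φ 1 ≤ 1)
    (A : 𝒜) (hA : 0 ≤ A) (p q r : ℝ) (hp : 0 ≤ p) (hq : 0 ≤ q) (hr : 0 ≤ r)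
    (hpq : p ≤ q) (hrq : r ≤ q) :
    ∃ U ∈ Matrix.unitaryGroup (Fin n) ℂ, ∃ V ∈ Matrix.unitaryGroup (Fin n) ℂ,
      CFC.abs (Φ (A ^ p) * Φ (A ^ q) * Φ (A ^ r)) ≤
        (2⁻¹ : ℂ) • (U * Φ (A ^ (p + q + r)) * star U + V * Φ (A ^ (p + q + r)) * star V) := by
  -- `t ≥ 0` comes from `p ≤ q` and `t ≤ 2` from `r ≤ q`. If `q = 0` then `p = r = 0`, and `t = 1`
  -- makes both `t` and `2 - t` at least 1, as the key estimate requires there.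
  obtain ⟨t, ht₀, ht₂, htq, hq₀⟩ :
      ∃ t : ℝ, 0 ≤ t ∧ t ≤ 2 ∧ t * q = q + r - p ∧ (q = 0 → t = 1) := by
    rcases hq.eq_or_lt with rfl | hq'
    · exact ⟨1, by norm_num, by norm_num, by linarith, fun _ => rfl⟩
    · refine ⟨(q + r - p) / q, div_nonneg (by linarith) hq, (div_le_iff₀ hq').2 (by linarith),
        by field_simp, fun h => absurd h hq'.ne'⟩
  have hB := Φ.map_rpow_nonneg A q
  have hX := Φ.unitarilyDominated_conj_map_rpow hΦ hA hp hq ht₀ ht₂ (fun h => (hq₀ h).ge)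
    (by linarith)
  have hY := Φ.unitarilyDominated_conj_map_rpow hΦ hA hr hq (t := 2 - t) (by linarith)
    (by linarith) (fun h => by linarith [hq₀ h]) (by linarith)
  rw [show 2 * p + t * q = p + q + r by linarith] at hX
  rw [show 2 * r + (2 - t) * q = p + q + r by linarith] at hY
  have hs : ∀ x : ℝ, star (Φ (A ^ q) ^ x) = Φ (A ^ q) ^ x := fun x =>
    (CFC.rpow_nonneg (a := Φ (A ^ q)) (y := x)).isSelfAdjoint.star_eq
  have hs' : ∀ x : ℝ, star (Φ (A ^ x)) = Φ (A ^ x) := fun x =>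
    (Φ.map_rpow_nonneg A x).isSelfAdjoint.star_eq
  obtain ⟨W, hW, h⟩ := Matrix.exists_unitary_two_smul_abs_mul_le
    (Φ (A ^ p) * Φ (A ^ q) ^ (t / 2)) (Φ (A ^ q) ^ ((2 - t) / 2) * Φ (A ^ r))
  have e₁ : Φ (A ^ p) * Φ (A ^ q) ^ (t / 2) * (Φ (A ^ q) ^ ((2 - t) / 2) * Φ (A ^ r)) =
      Φ (A ^ p) * Φ (A ^ q) * Φ (A ^ r) := by
    rw [mul_assoc, ← mul_assoc (Φ (A ^ q) ^ (t / 2)),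
      ← CFC.rpow_add_of_nonneg _ (by linarith) (by linarith),
      show t / 2 + (2 - t) / 2 = 1 by ring, CFC.rpow_one _ hB, mul_assoc]
  have e₂ : Φ (A ^ p) * Φ (A ^ q) ^ (t / 2) * star (Φ (A ^ p) * Φ (A ^ q) ^ (t / 2)) =
      Φ (A ^ p) * Φ (A ^ q) ^ t * Φ (A ^ p) := by
    rw [star_mul, hs, hs', mul_assoc, ← mul_assoc (Φ (A ^ q) ^ (t / 2)),
      ← CFC.rpow_add_of_nonneg _ (by linarith) (by linarith), add_halves, mul_assoc]
  have e₃ : star (Φ (A ^ q) ^ ((2 - t) / 2) * Φ (A ^ r)) *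
      (Φ (A ^ q) ^ ((2 - t) / 2) * Φ (A ^ r)) = Φ (A ^ r) * Φ (A ^ q) ^ (2 - t) * Φ (A ^ r) := by
    rw [star_mul, hs, hs', mul_assoc, ← mul_assoc (Φ (A ^ q) ^ ((2 - t) / 2)),
      ← CFC.rpow_add_of_nonneg _ (by linarith) (by linarith), add_halves, mul_assoc]
  rw [e₁, e₂, e₃] at h
  obtain ⟨U, hU, hX⟩ := hX
  obtain ⟨V, hV, hY⟩ := hY
  refine ⟨star W * U, mul_mem (Unitary.star_mem hW) hU, V, hV, ?_⟩
  have hX' := star_left_conjugate_le_conjugate hX W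
  have h' := h.trans (add_le_add hX' hY)
  have h₂ := smul_le_smul_of_nonneg_left h' (show (0 : ℝ) ≤ 2⁻¹ by norm_num)
  simp only [← Complex.coe_smul, smul_smul] at h₂
  norm_num at h₂
  simpa [mul_assoc] using h₂
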